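/- All processes are indexed by $t\in[0,\infty)$ and take values in $(-\infty,\infty]$ (in particular they may be real-valued); limits are taken in the extended real line, and $\stackrel{d}{=}$ between processes means equality of all finite-dimensional distributions. A process $H$ is called \emph{strong IDT} if for every $n\ge 1$ $$\{H_t\}_{t\ge 0}\stackrel{d}{=}\Big\{\sum_{i=1}^n H^{(i)}_{t/n}\Big\}_{t\ge 0},\qquad H^{(1)},\dots,H^{(n)}\text{ independent copies of }H.$$ A \emph{LePage series representation} of $H$ consists of a constant $b\in\mathbb{R}$ and a c\`adl\`ag process $f=\{f_t\}_{t\ge 0}$ (with left limits also in $(-\infty,\infty]$) with $f_0=0$, not almost surely identically zero, with $$\mathbb{E}\Big[\int_0^\infty \min\{1,|f_u|\}\,\frac{\mathrm{d}u}{u^2}\Big]<\infty,$$ such that $$\{H_t\}_{t\ge 0}\stackrel{d}{=}\Big\{b\,t+\sum_{k\ge 1} f^{(k)}_{t/(\epsilon_1+\dots+\epsilon_k)}\Big\}_{t\ge 0},$$ where $f^{(1)},f^{(2)},\dots$ are independent copies of $f$ (with c\`adl\`ag paths starting at $0$) and $\epsilon_1,\epsilon_2,\dots$ are i.i.d. unit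 exponential random variables independent of $(f^{(k)})_{k\ge1}$. \textbf{Lemma 1 (Non-decreasing strong IDT processes).} Let $H$ be a strong IDT process whose paths are almost surely non-decreasing and right-continuous. Then in every LePage series representation of $H$ the process $f$ is almost surely non-decreasing, and $b\ge 0$. -/

import Mathlib

open MeasureTheory ProbabilityTheory Filter Topology
open scoped NNReal ENNReal

/-- A stochastic process indexed by `[0, ∞)` with values in `(-∞, ∞]`. -/
structure IsProcess {Ω : Type*} [MeasurableSpace Ω] (X : ℝ≥0 → Ω → EReal) : Prop where
  measurable : ∀ t, Measurable (X t)
  ne_bot : ∀ t ω, X t ω ≠ ⊥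

/-- Equality in law of two processes: all finite-dimensional distributions agree (equivalently,
the laws on the product σ-algebra agree). -/
def SameLaw {Ω Ω' : Type*} [MeasurableSpace Ω] [MeasurableSpace Ω']
    (X : ℝ≥0 → Ω → EReal) (P : Measure Ω) (Y : ℝ≥0 → Ω' → EReal) (Q : Measure Ω') : Prop :=
  ∀ I : Finset ℝ≥0,
    IdentDistrib (fun ω (i : I) => X i ω) (fun ω (i : I) => Y i ω) P Q

/-- The process `H` is strongly infinitely divisible with respect to time: for every `n ≥ 1`,
`(H_t)_t` has the law of `(H⁽¹⁾_{t/n} + ⋯ + H⁽ⁿ⁾_{t/n})_t`, where the independent copies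
`H⁽ⁱ⁾` of `H` are realised as the coordinates of the `n`-fold product of the underlying
probability space. -/
def IsStrongIDT {Ω : Type*} [MeasurableSpace Ω] (H : ℝ≥0 → Ω → EReal) (P : Measure Ω) : Prop :=
  ∀ n : ℕ, 1 ≤ n →
    SameLaw H P (fun t (ω : Fin n → Ω) => ∑ i, H (t / n) (ω i)) (Measure.pi fun _ : Fin n => P)

/-- The space `𝔇` of càdlàg functions `g : [0, ∞) → (-∞, ∞]` with `g 0 = 0`. -/
structure IsCadlagFromZero (g : ℝ≥0 → EReal) : Prop where
  zero : g 0 = 0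
  ne_bot : ∀ t, g t ≠ ⊥
  right_cont : ∀ t, ContinuousWithinAt g (Set.Ici t) t
  left_lim : ∀ t, 0 < t → ∃ l : EReal, l ≠ ⊥ ∧ Tendsto g (𝓝[<] t) (𝓝 l)

/-- The sum of a LePage series, `b t + ∑_{k ≥ 1} f⁽ᵏ⁾_{t / (ε₁ + ⋯ + ε_k)}`
(with `k` shifted to start at `0`; the `ε_k` are real random variables that will be positive
almost surely). -/
noncomputable def lePageSeries {Ω : Type*} (b : ℝ) (F : ℕ → ℝ≥0 → Ω → EReal) (ε : ℕ → Ω → ℝ)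
    (t : ℝ≥0) (ω : Ω) : EReal :=
  ((b * (t : ℝ) : ℝ) : EReal) +
    ∑' k : ℕ, F k (t / Real.toNNReal (∑ j ∈ Finset.range (k + 1), ε j ω)) ω

/-- `(b, f)`, with copies `F k` of `f` and unit exponential variables `ε k`, is a LePage series
representation of the process `H`. The process `H` lives on `(Ω, P)`, the kernel process `f` on
`(Ω₁, P₁)` and the series on `(Ω₂, P₂)`. -/
structure IsLePageRepresentation {Ω Ω₁ Ω₂ : Type*}
    [MeasurableSpace Ω] [MeasurableSpace Ω₁] [MeasurableSpace Ω₂]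
    (H : ℝ≥0 → Ω → EReal) (P : Measure Ω) (b : ℝ)
    (f : ℝ≥0 → Ω₁ → EReal) (P₁ : Measure Ω₁)
    (F : ℕ → ℝ≥0 → Ω₂ → EReal) (ε : ℕ → Ω₂ → ℝ) (P₂ : Measure Ω₂) : Prop where
  /-- `f` is a stochastic process with paths in `𝔇` -/
  process : IsProcess f
  cadlag : ∀ ω, IsCadlagFromZero fun t => f t ω
  /-- `f` is non-vanishing: it is not almost surely the zero function -/
  nonvanishing : ¬ ∀ᵐ ω ∂P₁, ∀ t, f t ω = 0
  /-- `∫_𝔇 ∫₀^∞ min(1, |f(u)|) u⁻² du γ(df) < ∞`, where `γ` is the law of `f` -/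
  integral_lt_top :
    ∫⁻ ω, (∫⁻ u in Set.Ioi (0 : ℝ),
      (min 1 (f u.toNNReal ω).abs) / ENNReal.ofReal (u ^ 2)) ∂P₁ < ∞
  /-- the `F k` are independent copies of `f`, with paths in `𝔇` -/
  process_copy : ∀ k, IsProcess (F k)
  cadlag_copy : ∀ k ω, IsCadlagFromZero fun t => F k t ω
  sameLaw_copy : ∀ k, SameLaw (F k) P₂ f P₁
  indep_copy : iIndepFun (fun k ω t => F k t ω) P₂
  /-- the `ε k` are independent unit exponential random variables -/
  measurable_exp : ∀ k, Measurable (ε k)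
  law_exp : ∀ k, P₂.map (ε k) = expMeasure 1
  indep_exp : iIndepFun ε P₂
  /-- the two sequences are independent of each other -/
  indep : IndepFun (fun ω k t => F k t ω) (fun ω k => ε k ω) P₂
  /-- `H` has the law of the series -/
  sameLaw : SameLaw H P (lePageSeries b F ε) P₂

/-!
Write `Γ k = ε 0 + ⋯ + ε k` for the arrival times of the LePage series. They form a unit Poisson
process, but the proof uses only their first moments: the Erlang laws of the `Γ k` add up to
Lebesgue measure on `(0, ∞)` (`tsum_lintegral_erlangMeasure`). Hence (`lintegral_truncSum`) the
expectation of `∑ min(κ, |F k (t / Γ k)|)` is `t Φ(κ)`, where `Φ(κ) = ∫₀^∞ E min(κ, |f u|) u⁻² du`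
is finite for `κ = 1` and tends to `0` with `κ`. The representation transfers the monotonicity of
`H` to the series: almost surely its value at `s` is at most its value at `t`, for fixed `s ≤ t`.

*Drift.* If `b < 0`, choose `κ` with `Φ(κ) < |b|` and `t = κ / |b|`. By Markov's inequality the
truncated sum at `t` is smaller than `κ` with positive probability. On that event no truncation
takes place and the series is smaller than `b t + κ = 0` at `t`, although it vanishes at `0`.

*Monotone kernel.* Conditionally on the first path `F 0` and on `ε 0`, the remaining terms at time
`t` still have expected truncated size at most `t Φ(1)` (`setLIntegral_truncTail_le`), which is
negligible for small `t`, as is the drift. So if `F 0 (t / ε 0) + δ < F 0 (s / ε 0)` had positive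
probability for small `s ≤ t`, the series would decrease from `s` to `t` with positive probability
(`IsLePageRepresentation.measure_drop_eq_zero`). Since the law of `ε 0` is equivalent to Lebesgue
measure on `(0, ∞)`, right-continuity gives `f (s / x) ≤ f (t / x) + δ` for every `x > 0`, almost
surely. As `s` and `t` need only be small, with `x` as small, this compares `f` at any two given
positive times, and right-continuity passes from a countable dense set of times to all of them.
-/

/-! ### Partial sums of unit exponential variables -/

/-- The Erlang distribution with shape `k + 1` and rate `1`, the law of the sum of `k + 1`
independent unit exponential variables. The index is shifted as in `lePageSeries`. -/
noncomputable def erlangMeasure (k : ℕ) : Measure ℝ :=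
  (volume.restrict (Set.Ioi 0)).withDensity
    fun x => ENNReal.ofReal (x ^ k / k.factorial * Real.exp (-x))

instance sFinite_erlangMeasure (k : ℕ) : SFinite (erlangMeasure k) := by
  unfold erlangMeasure; infer_instance

lemma lintegral_erlangMeasure (k : ℕ) {h : ℝ → ℝ≥0∞} (hh : Measurable h) :
    ∫⁻ x, h x ∂erlangMeasure k =
      ∫⁻ x in Set.Ioi 0, ENNReal.ofReal (x ^ k / k.factorial * Real.exp (-x)) * h x := by
  rw [erlangMeasure, lintegral_withDensity_eq_lintegral_mul _ (by fun_prop) hh]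
  rfl

lemma expMeasure_one_eq_erlangMeasure : expMeasure 1 = erlangMeasure 0 := by
  rw [expMeasure, gammaMeasure, erlangMeasure, ← withDensity_indicator measurableSet_Ioi]
  refine withDensity_congr_ae ?_
  have h0 : ∀ᵐ x : ℝ, x ≠ 0 := by simp [ae_iff]
  filter_upwards [h0] with x hx
  rcases lt_or_gt_of_ne hx with h | h
  · rw [gammaPDF_of_neg h, Set.indicator_of_notMem (by simpa using h.le)]
  · rw [gammaPDF_of_nonneg h.le, Set.indicator_of_mem (by simpa using h)]
    simp

/-- The Erlang densities add up to `1`: the partial sums of unit exponential variables form a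
point process on `(0, ∞)` with Lebesgue intensity. -/
lemma tsum_lintegral_erlangMeasure {h : ℝ → ℝ≥0∞} (hh : Measurable h) :
    ∑' k, ∫⁻ x, h x ∂erlangMeasure k = ∫⁻ x in Set.Ioi 0, h x := by
  simp_rw [lintegral_erlangMeasure _ hh]
  rw [← lintegral_tsum (fun k => by fun_prop)]
  refine setLIntegral_congr_fun measurableSet_Ioi fun x hx => ?_
  simp only [Set.mem_Ioi] at hx
  simp only [ENNReal.tsum_mul_right]
  have hs : HasSum (fun k : ℕ => x ^ k / k.factorial * Real.exp (-x)) 1 := by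
    have := (NormedSpace.expSeries_div_hasSum_exp x).mul_right (Real.exp (-x))
    rwa [← Real.exp_eq_exp_ℝ, ← Real.exp_add, add_neg_cancel, Real.exp_zero] at this
  rw [← ENNReal.ofReal_tsum_of_nonneg (fun k => by positivity) hs.summable, hs.tsum_eq]
  simp

instance isProbabilityMeasure_erlangMeasure_zero : IsProbabilityMeasure (erlangMeasure 0) := by
  rw [← expMeasure_one_eq_erlangMeasure]
  exact isProbabilityMeasure_expMeasure one_pos

/-- Adding an independent unit exponential variable raises the Erlang shape by one. -/
lemma lintegral_erlangMeasure_succ (k : ℕ) {h : ℝ → ℝ≥0∞} (hh : Measurable h) :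
    ∫⁻ x, ∫⁻ y, h (x + y) ∂erlangMeasure 0 ∂erlangMeasure k =
      ∫⁻ x, h x ∂erlangMeasure (k + 1) := by
  have hm : Measurable fun x : ℝ => ∫⁻ y, h (x + y) ∂erlangMeasure 0 :=
    Measurable.lintegral_prod_right' (f := fun z : ℝ × ℝ => h (z.1 + z.2)) (by fun_prop)
  rw [lintegral_erlangMeasure k hm, lintegral_erlangMeasure (k + 1) hh]
  have key : ∀ x : ℝ, 0 < x →
      ENNReal.ofReal (x ^ k / k.factorial * Real.exp (-x)) * ∫⁻ y, h (x + y) ∂erlangMeasure 0 =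
      ∫⁻ v, (Set.Ioi x).indicator (fun v =>
        ENNReal.ofReal (x ^ k / k.factorial) * (ENNReal.ofReal (Real.exp (-v)) * h v)) v := by
    intro x hx
    rw [lintegral_erlangMeasure 0 (by fun_prop), lintegral_indicator measurableSet_Ioi,
      ← lintegral_const_mul _ (by fun_prop)]
    have hpre : Set.Ioi (0 : ℝ) = (fun y => x + y) ⁻¹' Set.Ioi x := by
      ext y; simp
    have := (measurePreserving_add_left (volume : Measure ℝ) x).setLIntegral_comp_preimage
      (s := Set.Ioi x) measurableSet_Ioi (f := fun v =>
        ENNReal.ofReal (x ^ k / k.factorial) * (ENNReal.ofReal (Real.exp (-v)) * h v))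
        (by fun_prop)
    rw [← this, ← hpre]
    refine setLIntegral_congr_fun measurableSet_Ioi fun y hy => ?_
    simp only [pow_zero, Nat.factorial_zero, Nat.cast_one, div_one, one_mul]
    rw [ENNReal.ofReal_mul (by positivity), neg_add, Real.exp_add,
      ENNReal.ofReal_mul (by positivity)]
    ring
  rw [setLIntegral_congr_fun measurableSet_Ioi (fun x hx => key x hx), lintegral_lintegral_swap]
  · rw [← lintegral_indicator measurableSet_Ioi]
    refine lintegral_congr fun v => ?_
    have hi : ∀ x : ℝ, (Set.Ioi x).indicator (fun v =>
        ENNReal.ofReal (x ^ k / k.factorial) * (ENNReal.ofReal (Real.exp (-v)) * h v)) v =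
        (Set.Iio v).indicator (fun x => ENNReal.ofReal (x ^ k / k.factorial)) x *
          (ENNReal.ofReal (Real.exp (-v)) * h v) := by
      intro x
      by_cases hxv : x < v <;> simp [Set.indicator, hxv]
    simp_rw [hi]
    rw [lintegral_mul_const _ ((by fun_prop : Measurable fun x : ℝ =>
      ENNReal.ofReal (x ^ k / k.factorial)).indicator measurableSet_Iio),
      lintegral_indicator measurableSet_Iio, Measure.restrict_restrict measurableSet_Iio]
    by_cases hv : 0 < v
    · rw [Set.indicator_of_mem (by simpa using hv)]
      have hint : ∫⁻ x in Set.Iio v ∩ Set.Ioi 0, ENNReal.ofReal (x ^ k / k.factorial) =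
          ENNReal.ofReal (v ^ (k + 1) / (k + 1).factorial) := by
        have hset : Set.Iio v ∩ Set.Ioi 0 = Set.Ioo 0 v := by ext x; simp [and_comm]
        rw [hset, restrict_Ioo_eq_restrict_Ioc, ← ofReal_integral_eq_lintegral_ofReal]
        · rw [← intervalIntegral.integral_of_le hv.le]
          simp only [intervalIntegral.integral_div, integral_pow]
          congr 1
          rw [Nat.factorial_succ]
          push_cast
          field_simp
          simp
        · exact ((by fun_prop : Continuous fun x : ℝ => x ^ k / k.factorial).integrableOn_Icc).mono_set
            Set.Ioc_subset_Icc_self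
        · filter_upwards [ae_restrict_mem measurableSet_Ioc] with x hx
          have := hx.1
          simp only [Pi.zero_apply]
          positivity
      rw [hint, ENNReal.ofReal_mul (by positivity)]
      ring
    · have : Set.Iio v ∩ Set.Ioi 0 = ∅ := by
        ext x
        simp only [Set.mem_inter_iff, Set.mem_Iio, Set.mem_Ioi, Set.mem_empty_iff_false, iff_false,
          not_and, not_lt]
        intro hx
        linarith
      rw [this, Set.indicator_of_notMem (by simpa using hv)]
      simp
  · refine Measurable.aemeasurable ?_
    have : (Function.uncurry fun x v : ℝ => (Set.Ioi x).indicator (fun v =>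
        ENNReal.ofReal (x ^ k / k.factorial) * (ENNReal.ofReal (Real.exp (-v)) * h v)) v) =
        {z : ℝ × ℝ | z.1 < z.2}.indicator (fun z =>
          ENNReal.ofReal (z.1 ^ k / k.factorial) * (ENNReal.ofReal (Real.exp (-z.2)) * h z.2)) := by
      ext z
      simp [Function.uncurry, Set.indicator]
    rw [this]
    exact Measurable.indicator (by fun_prop) (measurableSet_lt measurable_fst measurable_snd)

/-- A sum of `k + 1` independent unit exponential variables has the Erlang distribution. -/
lemma map_sum_range_eq_erlangMeasure {Ω : Type*} [MeasurableSpace Ω] {P : Measure Ω}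
    [IsProbabilityMeasure P] {ε : ℕ → Ω → ℝ} (hm : ∀ k, Measurable (ε k))
    (hlaw : ∀ k, P.map (ε k) = expMeasure 1) (hind : iIndepFun ε P) (k : ℕ) :
    P.map (fun ω => ∑ j ∈ Finset.range (k + 1), ε j ω) = erlangMeasure k := by
  induction k with
  | zero => simpa [← expMeasure_one_eq_erlangMeasure] using hlaw 0
  | succ k ih =>
    have hms : Measurable fun ω => ∑ j ∈ Finset.range (k + 1), ε j ω := by fun_prop
    have hi : IndepFun (fun ω => ∑ j ∈ Finset.range (k + 1), ε j ω) (ε (k + 1)) P := by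
      have := hind.indepFun_finsetSum_of_notMem (fun i => hm i)
        (s := Finset.range (k + 1)) (i := k + 1) (by simp)
      convert this using 1
      ext ω; simp
    refine Measure.ext_of_lintegral _ fun h hh => ?_
    simp_rw [Finset.sum_range_succ _ (k + 1)]
    rw [lintegral_map hh (by fun_prop), ← lintegral_erlangMeasure_succ k hh]
    have hpair := (indepFun_iff_map_prod_eq_prod_map_map hms.aemeasurable
      (hm (k + 1)).aemeasurable).1 hi
    rw [ih, hlaw, expMeasure_one_eq_erlangMeasure] at hpair
    rw [← lintegral_prod (fun z : ℝ × ℝ => h (z.1 + z.2)) (by fun_prop), ← hpair,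
      lintegral_map (by fun_prop) (by fun_prop)]

/-! ### Jointly measurable evaluation of right-continuous paths -/

/-- Evaluation of a path `p` at `u` as a limit of the values of `p` at grid points to the right of
`u`. It agrees with `p u` for right-continuous `p`, and unlike `p u` it is jointly measurable in
`(p, u)` when the space of all paths carries the product σ-algebra. -/
noncomputable def evalRight (p : ℝ≥0 → EReal) (u : ℝ≥0) : EReal :=
  limsup (fun n : ℕ => p ((⌊(n + 1) * u⌋₊ + 1) / (n + 1))) atTop

lemma evalRight_eq {p : ℝ≥0 → EReal} {u : ℝ≥0} (hp : ContinuousWithinAt p (Set.Ici u) u) :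
    evalRight p u = p u := by
  refine Tendsto.limsup_eq (hp.tendsto.comp (tendsto_nhdsWithin_iff.2 ⟨?_, ?_⟩))
  · have h1 : Tendsto (fun n : ℕ => u + 1 / ((n : ℝ≥0) + 1)) atTop (𝓝 u) := by
      simpa using (tendsto_const_nhds (x := u)).add (tendsto_one_div_add_atTop_nhds_zero_nat (𝕜 := ℝ≥0))
    refine tendsto_of_tendsto_of_tendsto_of_le_of_le tendsto_const_nhds h1 (fun n => ?_)
      (fun n => ?_)
    · rw [le_div_iff₀ (by positivity), mul_comm]
      exact (Nat.lt_floor_add_one _).le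
    · rw [div_le_iff₀ (by positivity), add_mul u, div_mul_cancel₀ _ (by positivity), mul_comm u]
      gcongr
      exact Nat.floor_le zero_le
  · refine Eventually.of_forall fun n => ?_
    simp only [Set.mem_Ici]
    rw [le_div_iff₀ (by positivity), mul_comm]
    exact (Nat.lt_floor_add_one _).le

lemma measurable_evalRight :
    Measurable fun z : (ℝ≥0 → EReal) × ℝ≥0 => evalRight z.1 z.2 := by
  refine Measurable.limsup fun n => ?_
  have h1 : Measurable fun w : (ℝ≥0 → EReal) × ℕ => w.1 (((w.2 : ℝ≥0) + 1) / (n + 1)) :=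
    measurable_from_prod_countable_left fun y =>
      measurable_pi_apply (((y : ℝ≥0) + 1) / (n + 1))
  have h2 : Measurable fun z : (ℝ≥0 → EReal) × ℝ≥0 => (z.1, ⌊((n : ℝ≥0) + 1) * z.2⌋₊) :=
    measurable_fst.prodMk (Nat.measurable_floor.comp (measurable_snd.const_mul _))
  exact h1.comp h2

@[fun_prop]
lemma Measurable.evalRight {α : Type*} [MeasurableSpace α] {p : α → ℝ≥0 → EReal} {u : α → ℝ≥0}
    (hp : Measurable p) (hu : Measurable u) : Measurable fun a => evalRight (p a) (u a) :=
  measurable_evalRight.comp (hp.prodMk hu)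

@[fun_prop]
lemma measurable_ereal_abs : Measurable EReal.abs :=
  EReal.measurable_of_measurable_real <|
    (by fun_prop : Measurable fun x : ℝ => ENNReal.ofReal |x|)

/-- The truncated size at time `t` of the summand of a LePage series with path `q` and arrival
time `y`. -/
noncomputable def truncAbs (κ : ℝ≥0∞) (t : ℝ≥0) (q : ℝ≥0 → EReal) (y : ℝ) : ℝ≥0∞ :=
  min κ (evalRight q (t / y.toNNReal)).abs

@[fun_prop]
lemma Measurable.truncAbs {α : Type*} [MeasurableSpace α] {κ : ℝ≥0∞} {t : ℝ≥0}
    {q : α → ℝ≥0 → EReal} {y : α → ℝ}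
    (hq : Measurable q) (hy : Measurable y) : Measurable fun a => truncAbs κ t (q a) (y a) := by
  unfold _root_.truncAbs
  exact measurable_const.min (measurable_ereal_abs.comp (hq.evalRight (by fun_prop)))

/-- The intensity `∫₀^∞ E min(κ, |f_u|) u⁻² du` of a kernel law `γ`. -/
noncomputable def truncIntensity (γ : Measure (ℝ≥0 → EReal)) (κ : ℝ≥0∞) : ℝ≥0∞ :=
  ∫⁻ q, (∫⁻ u in Set.Ioi (0 : ℝ),
    min κ (evalRight q u.toNNReal).abs / ENNReal.ofReal (u ^ 2)) ∂γ

/-- The substitution `u = t / y`. -/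
lemma setLIntegral_Ioi_div {t : ℝ} (ht : 0 < t) {h : ℝ → ℝ≥0∞} (hh : Measurable h) :
    ∫⁻ y in Set.Ioi (0 : ℝ), h (t / y) =
      ENNReal.ofReal t * ∫⁻ u in Set.Ioi (0 : ℝ), h u / ENNReal.ofReal (u ^ 2) := by
  have himg : (fun y : ℝ => t / y) '' Set.Ioi 0 = Set.Ioi 0 := by
    ext u
    simp only [Set.mem_image, Set.mem_Ioi]
    refine ⟨fun ⟨y, hy, e⟩ => e ▸ div_pos ht hy, fun hu => ⟨t / u, div_pos ht hu, ?_⟩⟩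
    field_simp
  have := lintegral_image_eq_lintegral_abs_deriv_mul (s := Set.Ioi (0 : ℝ)) measurableSet_Ioi
    (f := fun y => t / y) (f' := fun y => -t / y ^ 2)
    (fun y hy => by
      have h := ((hasDerivAt_inv (ne_of_gt hy)).const_mul t).hasDerivWithinAt (s := Set.Ioi 0)
      rwa [show t * -(y ^ 2)⁻¹ = -t / y ^ 2 by ring] at h)
    (fun x hx y hy e => by
      have hx' : x ≠ 0 := ne_of_gt hx
      have hy' : y ≠ 0 := ne_of_gt hy
      field_simp at e
      exact e.symm)
    (fun u => h u / ENNReal.ofReal (u ^ 2))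
  rw [himg] at this
  rw [this, ← lintegral_const_mul _ (by fun_prop)]
  refine setLIntegral_congr_fun measurableSet_Ioi fun y hy => ?_
  simp only [Set.mem_Ioi] at hy
  have e1 : |-t / y ^ 2| = t / y ^ 2 := by
    rw [neg_div, abs_neg, abs_of_pos (by positivity)]
  simp only [e1]
  rw [ENNReal.div_eq_inv_mul, ← mul_assoc, ← mul_assoc, ← ENNReal.ofReal_inv_of_pos (by positivity),
    ← ENNReal.ofReal_mul (by positivity), ← ENNReal.ofReal_mul (by positivity)]
  have : t * (t / y ^ 2) * ((t / y) ^ 2)⁻¹ = 1 := by field_simp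
  rw [this]
  simp

/-- The substitution `u = t / y` turns the intensity measure `u⁻² du` into Lebesgue measure. -/
lemma lintegral_truncAbs (γ : Measure (ℝ≥0 → EReal)) [SFinite γ] (κ : ℝ≥0∞) {t : ℝ≥0} (ht : 0 < t) :
    ∫⁻ q, (∫⁻ y in Set.Ioi (0 : ℝ), truncAbs κ t q y) ∂γ = t * truncIntensity γ κ := by
  rw [truncIntensity, ← lintegral_const_mul _ (Measurable.lintegral_prod_right'
    (f := fun z : (ℝ≥0 → EReal) × ℝ =>
      min κ (evalRight z.1 z.2.toNNReal).abs / ENNReal.ofReal (z.2 ^ 2))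
    (by fun_prop))]
  refine lintegral_congr fun q => ?_
  have := setLIntegral_Ioi_div (t := t) ht (h := fun u => min κ (evalRight q u.toNNReal).abs)
    (by fun_prop)
  rw [ENNReal.ofReal_coe_nnreal] at this
  rw [← this]
  refine setLIntegral_congr_fun measurableSet_Ioi fun y hy => ?_
  simp only [truncAbs]
  rw [Real.toNNReal_div t.coe_nonneg, Real.toNNReal_coe]

/-- The intensity of the truncated sizes vanishes as the truncation level `(n + 1)⁻¹` does. -/
lemma tendsto_truncIntensity (γ : Measure (ℝ≥0 → EReal)) [SFinite γ]
    (h1 : truncIntensity γ 1 ≠ ∞) :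
    Tendsto (fun n : ℕ => truncIntensity γ ((n : ℝ≥0∞) + 1)⁻¹) atTop (𝓝 0) := by
  have hm : ∀ κ : ℝ≥0∞, Measurable fun z : (ℝ≥0 → EReal) × ℝ =>
      min κ (evalRight z.1 z.2.toNNReal).abs / ENNReal.ofReal (z.2 ^ 2) := fun κ => by fun_prop
  have hp : ∀ κ, truncIntensity γ κ = ∫⁻ z, min κ (evalRight z.1 z.2.toNNReal).abs /
      ENNReal.ofReal (z.2 ^ 2) ∂γ.prod (volume.restrict (Set.Ioi 0)) := fun κ => by
    rw [lintegral_prod _ (hm κ).aemeasurable, truncIntensity]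
  simp_rw [hp]
  rw [hp] at h1
  rw [← lintegral_zero (μ := γ.prod (volume.restrict (Set.Ioi (0 : ℝ))))]
  refine tendsto_lintegral_of_dominated_convergence _ (fun n => hm _)
    (fun n => Eventually.of_forall fun z => ?_) h1 ?_
  · exact ENNReal.div_le_div_right (min_le_min_right _ (ENNReal.inv_le_one.2 (by simp))) _
  · have hpos : ∀ᵐ z ∂γ.prod (volume.restrict (Set.Ioi (0 : ℝ))), 0 < z.2 :=
      Measure.quasiMeasurePreserving_snd.ae (ae_restrict_mem measurableSet_Ioi)
    filter_upwards [hpos] with z hz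
    have h0 : ENNReal.ofReal (z.2 ^ 2) ≠ 0 := by simpa using by positivity
    have hk : Tendsto (fun n : ℕ => ((n : ℝ≥0∞) + 1)⁻¹) atTop (𝓝 0) := by
      have := (tendsto_add_atTop_iff_nat 1).2 ENNReal.tendsto_inv_nat_nhds_zero
      simpa using this
    have hk' : Tendsto (fun n : ℕ => ((n : ℝ≥0∞) + 1)⁻¹ / ENNReal.ofReal (z.2 ^ 2)) atTop
        (𝓝 0) := by
      simpa using ENNReal.Tendsto.div_const hk (Or.inr h0)
    exact tendsto_of_tendsto_of_tendsto_of_le_of_le tendsto_const_nhds hk' (fun _ => zero_le)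
      (fun n => by gcongr; exact min_le_left _ _)

/-! ### Series in the extended reals -/

/-- If `∑ min(κ, |a k|) < c ≤ κ`, then the truncation is inactive, and `a` is an absolutely
summable real sequence with sum smaller than `c` in absolute value. -/
lemma exists_hasSum_of_tsum_min_lt {κ : ℝ≥0∞} {c : ℝ} {a : ℕ → EReal}
    (hc : ENNReal.ofReal c ≤ κ) (h : ∑' k, min κ (a k).abs < ENNReal.ofReal c) :
    ∃ (r : ℕ → ℝ) (S : ℝ), (∀ k, a k = r k) ∧ HasSum r S ∧ |S| < c := by
  have hlt : ∀ k, min κ (a k).abs < κ := fun k =>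
    ((ENNReal.le_tsum k).trans_lt h).trans_le hc
  have hmin : ∀ k, min κ (a k).abs = (a k).abs := fun k =>
    min_eq_right (le_of_lt (by simpa using hlt k))
  simp_rw [hmin] at h
  have hfin : ∀ k, (a k).abs ≠ ∞ := fun k => ENNReal.ne_top_of_tsum_ne_top h.ne_top k
  have hr : ∀ k, a k = ((a k).toReal : EReal) := fun k =>
    (EReal.coe_toReal (fun e => hfin k (by simp [e])) (fun e => hfin k (by simp [e]))).symm
  have habs : ∀ k, (a k).abs = ‖(a k).toReal‖ₑ := fun k => by
    conv_lhs => rw [hr k]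
    rw [EReal.abs_def, ← Real.norm_eq_abs, ofReal_norm]
  simp_rw [habs] at h
  have hsum : Summable fun k => (a k).toReal := Summable.of_enorm h.ne_top
  refine ⟨fun k => (a k).toReal, _, hr, hsum.hasSum, ?_⟩
  have h2 : ‖∑' k, (a k).toReal‖ₑ < ENNReal.ofReal c := (enorm_tsum_le_tsum_enorm).trans_lt h
  rw [← ofReal_norm, ENNReal.ofReal_lt_ofReal_iff_of_nonneg (norm_nonneg _)] at h2
  exact h2

/-- A series in `(-∞, ∞]` whose terms after the first form a convergent real series. -/
lemma EReal.tsum_eq_add_coe {a : ℕ → EReal} {r : ℕ → ℝ} {S : ℝ} (h0 : a 0 ≠ ⊥)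
    (hr : ∀ k, a (k + 1) = r k) (hS : HasSum r S) : ∑' k, a k = a 0 + S := by
  set r' : ℕ → ℝ := fun n => Nat.casesOn n 0 r with hr'
  have hS' : HasSum r' S := by
    rw [← hasSum_nat_add_iff' 1]
    simpa [hr'] using hS
  refine HasSum.tsum_eq ?_
  have hco : Tendsto (fun x : EReal => a 0 + x) (𝓝 (S : EReal)) (𝓝 (a 0 + S)) := by
    have := EReal.continuousAt_add (p := (a 0, (S : EReal))) (Or.inr (by simp)) (Or.inl h0)
    exact this.tendsto.comp (tendsto_const_nhds.prodMk_nhds tendsto_id)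
  have := hco.comp ((continuous_coe_real_ereal.tendsto S).comp hS')
  refine this.congr' ?_
  filter_upwards [eventually_ge_atTop ({0} : Finset ℕ)] with s hs
  have h0s : 0 ∈ s := hs (by simp)
  have hcoe : ∀ u : Finset ℕ, ((∑ i ∈ u, r' i : ℝ) : EReal) = ∑ i ∈ u, (r' i : EReal) := fun u => by
    induction u using Finset.induction_on with
    | empty => simp
    | insert i u hi ih => rw [Finset.sum_insert hi, Finset.sum_insert hi, EReal.coe_add, ih]
  simp only [Function.comp_apply, hcoe]
  rw [← Finset.add_sum_erase _ _ h0s, ← Finset.add_sum_erase s a h0s]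
  rw [show r' 0 = 0 from rfl, EReal.coe_zero, zero_add]
  congr 1
  refine Finset.sum_congr rfl fun i hi => ?_
  cases i with
  | zero => simp at hi
  | succ i => exact (hr i).symm

lemma EReal.tsum_eq_coe {a : ℕ → EReal} {r : ℕ → ℝ} {S : ℝ}
    (hr : ∀ k, a k = r k) (hS : HasSum r S) : ∑' k, a k = S := by
  obtain rfl : a = fun k => (r k : EReal) := funext hr
  have h := hS.map (⟨⟨((↑) : ℝ → EReal), EReal.coe_zero⟩, EReal.coe_add⟩ : ℝ →+ EReal)
    continuous_coe_real_ereal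
  exact h.tsum_eq

/-! ### Moments of the LePage series -/

/-- Equality of the finite-dimensional distributions is equality of the laws on path space. -/
lemma SameLaw.map_eq {Ω Ω' : Type*} [MeasurableSpace Ω] [MeasurableSpace Ω']
    {X : ℝ≥0 → Ω → EReal} {P : Measure Ω} {Y : ℝ≥0 → Ω' → EReal} {Q : Measure Ω'}
    [IsFiniteMeasure P] [IsFiniteMeasure Q]
    (h : SameLaw X P Y Q) (hX : ∀ t, Measurable (X t)) (hY : ∀ t, Measurable (Y t)) :
    P.map (fun ω t => X t ω) = Q.map (fun ω t => Y t ω) := by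
  have hX' : Measurable fun ω t => X t ω := measurable_pi_lambda _ hX
  have hY' : Measurable fun ω t => Y t ω := measurable_pi_lambda _ hY
  refine IsProjectiveLimit.unique (P := fun I : Finset ℝ≥0 => P.map fun ω => I.restrict (X · ω))
    (isProjectiveLimit_map hX'.aemeasurable) fun I => ?_
  rw [isProjectiveLimit_map hY'.aemeasurable I]
  exact (h I).map_eq.symm

section Moments

variable {Ω : Type*} [MeasurableSpace Ω] {P : Measure Ω} [IsProbabilityMeasure P]
  {γ : Measure (ℝ≥0 → EReal)}
  {X : ℕ → Ω → ℝ≥0 → EReal} {ε : ℕ → Ω → ℝ}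

/-- The total truncated size of the LePage series at time `t`, as a random variable. -/
noncomputable def truncSum (X : ℕ → Ω → ℝ≥0 → EReal) (ε : ℕ → Ω → ℝ) (κ : ℝ≥0∞) (t : ℝ≥0)
    (ω : Ω) : ℝ≥0∞ :=
  ∑' k, truncAbs κ t (X k ω) (∑ j ∈ Finset.range (k + 1), ε j ω)

/-- The truncated size of the LePage series at time `t` without its first summand. -/
noncomputable def truncTail (X : ℕ → Ω → ℝ≥0 → EReal) (ε : ℕ → Ω → ℝ) (κ : ℝ≥0∞) (t : ℝ≥0)
    (ω : Ω) : ℝ≥0∞ :=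
  ∑' k, truncAbs κ t (X (k + 1) ω) (∑ j ∈ Finset.range (k + 2), ε j ω)

lemma measurable_truncTail (hX : ∀ k, Measurable (X k)) (hε : ∀ k, Measurable (ε k)) (κ : ℝ≥0∞)
    (t : ℝ≥0) : Measurable (truncTail X ε κ t) := by
  unfold truncTail; fun_prop

/-- Campbell's formula for the point process of pairs (path, arrival time). -/
lemma lintegral_truncSum [SFinite γ] (hX : ∀ k, Measurable (X k)) (hε : ∀ k, Measurable (ε k))
    (hXlaw : ∀ k, P.map (X k) = γ) (hεlaw : ∀ k, P.map (ε k) = expMeasure 1)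
    (hεind : iIndepFun ε P) (hind : IndepFun (fun ω k => X k ω) (fun ω k => ε k ω) P)
    (κ : ℝ≥0∞) {t : ℝ≥0} (ht : 0 < t) :
    ∫⁻ ω, truncSum X ε κ t ω ∂P = t * truncIntensity γ κ := by
  rw [← lintegral_truncAbs γ κ ht]
  unfold truncSum
  rw [lintegral_tsum (fun k => by fun_prop)]
  have hk : ∀ k, ∫⁻ ω, truncAbs κ t (X k ω) (∑ j ∈ Finset.range (k + 1), ε j ω) ∂P =
      ∫⁻ q, ∫⁻ y, truncAbs κ t q y ∂erlangMeasure k ∂γ := fun k => by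
    have hi : IndepFun (X k) (fun ω => ∑ j ∈ Finset.range (k + 1), ε j ω) P :=
      hind.comp (φ := fun p : ℕ → ℝ≥0 → EReal => p k)
        (ψ := fun e : ℕ → ℝ => ∑ j ∈ Finset.range (k + 1), e j) (by fun_prop) (by fun_prop)
    have hlawΓ := map_sum_range_eq_erlangMeasure hε hεlaw hεind k
    have hp := (indepFun_iff_map_prod_eq_prod_map_map (hX k).aemeasurable (by fun_prop)).1 hi
    rw [hXlaw, hlawΓ] at hp
    rw [← lintegral_prod (fun z : (ℝ≥0 → EReal) × ℝ => truncAbs κ t z.1 z.2) (by fun_prop), ← hp,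
      lintegral_map (by fun_prop) (by fun_prop)]
  simp_rw [hk]
  rw [← lintegral_tsum (fun k => (Measurable.lintegral_prod_right'
    (f := fun z : (ℝ≥0 → EReal) × ℝ => truncAbs κ t z.1 z.2) (by fun_prop)).aemeasurable)]
  exact lintegral_congr fun q => tsum_lintegral_erlangMeasure (by fun_prop)

/-- The law of two paths, the first arrival time and the time elapsed from it to a later one. -/
lemma map_pairs_eq (hX : ∀ k, Measurable (X k)) (hε : ∀ k, Measurable (ε k))
    (hXlaw : ∀ k, P.map (X k) = γ) (hεlaw : ∀ k, P.map (ε k) = expMeasure 1)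
    (hXind : iIndepFun X P) (hεind : iIndepFun ε P)
    (hind : IndepFun (fun ω k => X k ω) (fun ω k => ε k ω) P) (k : ℕ) :
    P.map (fun ω => ((X 0 ω, X (k + 1) ω),
      (ε 0 ω, ∑ j ∈ Finset.range (k + 1), ε (j + 1) ω))) =
      (γ.prod γ).prod ((erlangMeasure 0).prod (erlangMeasure k)) := by
  have h1 : P.map (fun ω => (X 0 ω, X (k + 1) ω)) = γ.prod γ := by
    rw [(indepFun_iff_map_prod_eq_prod_map_map (hX 0).aemeasurable (hX _).aemeasurable).1
      (hXind.indepFun (by simp)), hXlaw, hXlaw]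
  have h2 : P.map (fun ω => (ε 0 ω, ∑ j ∈ Finset.range (k + 1), ε (j + 1) ω)) =
      (erlangMeasure 0).prod (erlangMeasure k) := by
    have hi : IndepFun (ε 0) (fun ω => ∑ j ∈ Finset.range (k + 1), ε (j + 1) ω) P := by
      have := hεind.indepFun_finsetSum_of_notMem (fun i => hε i)
        (s := (Finset.range (k + 1)).map ⟨Nat.succ, Nat.succ_injective⟩) (i := 0) (by simp)
      convert this.symm using 1
      ext ω; simp
    rw [(indepFun_iff_map_prod_eq_prod_map_map (hε 0).aemeasurable (by fun_prop)).1 hi, hεlaw,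
      expMeasure_one_eq_erlangMeasure]
    congr 1
    exact map_sum_range_eq_erlangMeasure (fun j => hε (j + 1)) (fun j => hεlaw (j + 1))
      (hεind.precomp (g := Nat.succ) Nat.succ_injective) k
  have h3 := hind.comp (φ := fun p : ℕ → ℝ≥0 → EReal => (p 0, p (k + 1)))
    (ψ := fun e : ℕ → ℝ => (e 0, ∑ j ∈ Finset.range (k + 1), e (j + 1))) (by fun_prop) (by fun_prop)
  have h4 := (indepFun_iff_map_prod_eq_prod_map_map (by fun_prop) (by fun_prop)).1 h3
  rw [← h1, ← h2]
  exact h4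

/-- Conditionally on the first path and the first arrival time, the truncated size of the
remaining terms still has mean at most `t * truncIntensity γ κ`: the later arrival times are those
of a unit Poisson process started at the first one. -/
lemma setLIntegral_truncTail_le [SFinite γ] (hX : ∀ k, Measurable (X k)) (hε : ∀ k, Measurable (ε k))
    (hXlaw : ∀ k, P.map (X k) = γ) (hεlaw : ∀ k, P.map (ε k) = expMeasure 1)
    (hXind : iIndepFun X P) (hεind : iIndepFun ε P)
    (hind : IndepFun (fun ω k => X k ω) (fun ω k => ε k ω) P)
    (κ : ℝ≥0∞) {t : ℝ≥0} (ht : 0 < t) {A : Set ((ℝ≥0 → EReal) × ℝ)} (hA : MeasurableSet A) :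
    ∫⁻ ω in {ω | (X 0 ω, ε 0 ω) ∈ A}, truncTail X ε κ t ω ∂P ≤
      γ.prod (erlangMeasure 0) A * (t * truncIntensity γ κ) := by
  have hA' : MeasurableSet {ω | (X 0 ω, ε 0 ω) ∈ A} := ((hX 0).prodMk (hε 0)) hA
  set a : (ℝ≥0 → EReal) × ℝ → ℝ≥0∞ := A.indicator 1 with ha
  have ham : Measurable a := measurable_one.indicator hA
  rw [← lintegral_indicator hA']
  have hterm : ∀ ω, {ω | (X 0 ω, ε 0 ω) ∈ A}.indicator (truncTail X ε κ t) ω =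
      ∑' k, a (X 0 ω, ε 0 ω) * truncAbs κ t (X (k + 1) ω)
        (ε 0 ω + ∑ j ∈ Finset.range (k + 1), ε (j + 1) ω) := fun ω => by
    rw [ENNReal.tsum_mul_left]
    by_cases hω : (X 0 ω, ε 0 ω) ∈ A
    · rw [Set.indicator_of_mem (by exact hω), ha, Set.indicator_of_mem hω, Pi.one_apply, one_mul,
        truncTail]
      refine tsum_congr fun k => ?_
      rw [Finset.sum_range_succ' _ (k + 1), add_comm _ (ε 0 ω)]
    · rw [Set.indicator_of_notMem (by exact hω), ha, Set.indicator_of_notMem hω, zero_mul]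
  simp_rw [hterm]
  rw [lintegral_tsum (fun k => by fun_prop)]
  have hk : ∀ k, ∫⁻ ω, a (X 0 ω, ε 0 ω) * truncAbs κ t (X (k + 1) ω)
        (ε 0 ω + ∑ j ∈ Finset.range (k + 1), ε (j + 1) ω) ∂P =
      ∫⁻ z : (ℝ≥0 → EReal) × (ℝ≥0 → EReal), ∫⁻ x, a (z.1, x) *
        ∫⁻ y, truncAbs κ t z.2 (x + y) ∂erlangMeasure k ∂erlangMeasure 0 ∂(γ.prod γ) := fun k => by
    have h := map_pairs_eq hX hε hXlaw hεlaw hXind hεind hind k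
    have hm4 : Measurable fun w : ((ℝ≥0 → EReal) × (ℝ≥0 → EReal)) × ℝ × ℝ =>
        a (w.1.1, w.2.1) * truncAbs κ t w.1.2 (w.2.1 + w.2.2) := by fun_prop
    have e : ∫⁻ ω, a (X 0 ω, ε 0 ω) * truncAbs κ t (X (k + 1) ω)
        (ε 0 ω + ∑ j ∈ Finset.range (k + 1), ε (j + 1) ω) ∂P =
        ∫⁻ w, a (w.1.1, w.2.1) * truncAbs κ t w.1.2 (w.2.1 + w.2.2) ∂(P.map fun ω =>
          ((X 0 ω, X (k + 1) ω), (ε 0 ω, ∑ j ∈ Finset.range (k + 1), ε (j + 1) ω))) := by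
      rw [lintegral_map (by fun_prop) (by fun_prop)]
    rw [e, h, lintegral_prod _ hm4.aemeasurable]
    refine lintegral_congr fun z => ?_
    have hm5 : Measurable fun y : ℝ × ℝ => a (z.1, y.1) * truncAbs κ t z.2 (y.1 + y.2) :=
      hm4.comp (measurable_prodMk_left (x := z))
    refine (lintegral_prod _ hm5.aemeasurable).trans (lintegral_congr fun x => ?_)
    exact lintegral_const_mul (a (z.1, x)) (f := fun y => truncAbs κ t z.2 (x + y)) (by fun_prop)
  simp_rw [hk]
  have hm3 : ∀ k, Measurable fun w : ((ℝ≥0 → EReal) × (ℝ≥0 → EReal)) × ℝ =>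
      a (w.1.1, w.2) * ∫⁻ y, truncAbs κ t w.1.2 (w.2 + y) ∂erlangMeasure k := fun k => by
    refine Measurable.mul (by fun_prop) ?_
    exact Measurable.lintegral_prod_right' (f := fun v : (((ℝ≥0 → EReal) × (ℝ≥0 → EReal)) × ℝ) × ℝ =>
      truncAbs κ t v.1.1.2 (v.1.2 + v.2)) (by fun_prop)
  rw [← lintegral_tsum (fun k => (Measurable.lintegral_prod_right' (hm3 k)).aemeasurable)]
  have hpos : ∀ᵐ x ∂erlangMeasure 0, 0 < x :=
    (withDensity_absolutelyContinuous _ _).ae_le (ae_restrict_mem measurableSet_Ioi)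
  have hG : Measurable fun q => ∫⁻ y in Set.Ioi (0 : ℝ), truncAbs κ t q y :=
    Measurable.lintegral_prod_right' (f := fun v : (ℝ≥0 → EReal) × ℝ => truncAbs κ t v.1 v.2)
      (by fun_prop)
  have hm0 : Measurable fun p => ∫⁻ x, a (p, x) ∂erlangMeasure 0 :=
    Measurable.lintegral_prod_right' ham
  calc ∫⁻ z : (ℝ≥0 → EReal) × (ℝ≥0 → EReal), ∑' k, ∫⁻ x, a (z.1, x) *
        ∫⁻ y, truncAbs κ t z.2 (x + y) ∂erlangMeasure k ∂erlangMeasure 0 ∂(γ.prod γ)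
      ≤ ∫⁻ z : (ℝ≥0 → EReal) × (ℝ≥0 → EReal), (∫⁻ x, a (z.1, x) ∂erlangMeasure 0) *
          (∫⁻ y in Set.Ioi (0 : ℝ), truncAbs κ t z.2 y) ∂(γ.prod γ) := by
        refine lintegral_mono fun z => ?_
        have hm5 : ∀ k, Measurable fun x => a (z.1, x) *
            ∫⁻ y, truncAbs κ t z.2 (x + y) ∂erlangMeasure k := fun k =>
          (hm3 k).comp (measurable_prodMk_left (x := z))
        rw [← lintegral_tsum (fun k => (hm5 k).aemeasurable),
          ← lintegral_mul_const _ (by fun_prop)]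
        refine lintegral_mono_ae ?_
        filter_upwards [hpos] with x hx
        rw [ENNReal.tsum_mul_left]
        gcongr
        rw [tsum_lintegral_erlangMeasure (by fun_prop)]
        -- translating `(0, ∞)` by `x > 0` gives a subset of `(0, ∞)`
        have := (measurePreserving_add_left (volume : Measure ℝ) x).setLIntegral_comp_preimage
          (s := Set.Ioi x) measurableSet_Ioi (f := fun v => truncAbs κ t z.2 v) (by fun_prop)
        have hpre : (fun y => x + y) ⁻¹' Set.Ioi x = Set.Ioi 0 := by
          ext y; simp
        rw [hpre] at this
        rw [this]
        exact lintegral_mono_set (Set.Ioi_subset_Ioi hx.le)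
    _ = γ.prod (erlangMeasure 0) A * (t * truncIntensity γ κ) := by
        rw [lintegral_prod_mul hm0.aemeasurable hG.aemeasurable, lintegral_truncAbs γ κ ht,
          ← lintegral_prod _ ham.aemeasurable, ha, lintegral_indicator_one hA]

end Moments

/-! ### Pathwise bounds on the LePage series -/

section Pathwise

variable {Ω₂ : Type*} {b : ℝ} {F : ℕ → ℝ≥0 → Ω₂ → EReal} {ε : ℕ → Ω₂ → ℝ}

lemma IsCadlagFromZero.evalRight_eq {g : ℝ≥0 → EReal} (hg : IsCadlagFromZero g) (u : ℝ≥0) :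
    evalRight g u = g u :=
  _root_.evalRight_eq (hg.right_cont u)

/-- If the truncated size is small, the series at time `t` is real and differs from its drift by
less than `c`. -/
lemma exists_lePageSeries_eq_of_truncSum_lt (hcad : ∀ k ω, IsCadlagFromZero fun t => F k t ω)
    {κ : ℝ≥0∞} {c : ℝ} {t : ℝ≥0} {ω : Ω₂} (hc : ENNReal.ofReal c ≤ κ)
    (h : truncSum (fun k ω t => F k t ω) ε κ t ω < ENNReal.ofReal c) :
    ∃ S : ℝ, |S| < c ∧ lePageSeries b F ε t ω = ((b * t + S : ℝ) : EReal) := by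
  simp only [truncSum, truncAbs, (hcad _ _).evalRight_eq] at h
  obtain ⟨r, S, hr, hS, hSc⟩ := exists_hasSum_of_tsum_min_lt hc h
  refine ⟨S, hSc, ?_⟩
  rw [lePageSeries, EReal.tsum_eq_coe hr hS, ← EReal.coe_add]

/-- If the truncated size of the later terms is small, the series at time `t` differs from its
first summand by the drift and an error less than `c`. -/
lemma exists_lePageSeries_eq_of_truncTail_lt (hcad : ∀ k ω, IsCadlagFromZero fun t => F k t ω)
    {κ : ℝ≥0∞} {c : ℝ} {t : ℝ≥0} {ω : Ω₂} (hc : ENNReal.ofReal c ≤ κ)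
    (h : truncTail (fun k ω t => F k t ω) ε κ t ω < ENNReal.ofReal c) :
    ∃ S : ℝ, |S| < c ∧ lePageSeries b F ε t ω =
      ((b * t : ℝ) : EReal) + (F 0 (t / (ε 0 ω).toNNReal) ω + (S : EReal)) := by
  simp only [truncTail, truncAbs, (hcad _ _).evalRight_eq] at h
  obtain ⟨r, S, hr, hS, hSc⟩ := exists_hasSum_of_tsum_min_lt hc h
  refine ⟨S, hSc, ?_⟩
  rw [lePageSeries, EReal.tsum_eq_add_coe ((hcad _ _).ne_bot _) hr hS]
  simp

lemma lePageSeries_zero (hcad : ∀ k ω, IsCadlagFromZero fun t => F k t ω) (ω : Ω₂) :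
    lePageSeries b F ε 0 ω = 0 := by
  have h : ∀ k, F k 0 ω = 0 := fun k => (hcad k ω).zero
  simp [lePageSeries, h]

/-- A gap `δ` between `x` and `y` survives real perturbations that change it by less than `δ`. -/
lemma EReal.add_coe_lt_add_coe_of_gap {x y : EReal} {δ p q r s : ℝ} (hx : x ≠ ⊥)
    (hgap : x + δ < y) (h : p + r - δ < q + s) :
    (p : EReal) + (x + (r : EReal)) < (q : EReal) + (y + (s : EReal)) := by
  induction x with
  | bot => exact absurd rfl hx
  | top => simp at hgap
  | coe x =>
    induction y with
    | bot => simp at hgap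
    | top =>
      rw [EReal.top_add_coe, EReal.coe_add_top, ← EReal.coe_add, ← EReal.coe_add]
      exact EReal.coe_lt_top _
    | coe y =>
      norm_cast at hgap ⊢
      linarith

end Pathwise

/-! ### Consequences of monotonicity -/

section Representation

variable {Ω Ω₁ Ω₂ : Type*} [MeasurableSpace Ω] [MeasurableSpace Ω₁] [MeasurableSpace Ω₂]
  {P : Measure Ω} {P₁ : Measure Ω₁} {P₂ : Measure Ω₂}
  {H : ℝ≥0 → Ω → EReal} {b : ℝ} {f : ℝ≥0 → Ω₁ → EReal} {F : ℕ → ℝ≥0 → Ω₂ → EReal}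
  {ε : ℕ → Ω₂ → ℝ}

lemma IsLePageRepresentation.ae_lePageSeries_le (hrep : IsLePageRepresentation H P b f P₁ F ε P₂)
    (hmono : ∀ᵐ ω ∂P, Monotone fun t => H t ω) {s t : ℝ≥0} (hst : s ≤ t) :
    ∀ᵐ ω ∂P₂, lePageSeries b F ε s ω ≤ lePageSeries b F ε t ω := by
  have hs : s ∈ ({s, t} : Finset ℝ≥0) := by simp
  have ht : t ∈ ({s, t} : Finset ℝ≥0) := by simp
  refine (hrep.sameLaw {s, t}).ae_snd (p := fun x => x ⟨s, hs⟩ ≤ x ⟨t, ht⟩)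
    (measurableSet_le (measurable_pi_apply _) (measurable_pi_apply _)) ?_
  filter_upwards [hmono] with ω h using h hst

lemma IsLePageRepresentation.measurable_copy (hrep : IsLePageRepresentation H P b f P₁ F ε P₂)
    (k : ℕ) : Measurable fun ω t => F k t ω :=
  measurable_pi_lambda _ (hrep.process_copy k).measurable

lemma IsLePageRepresentation.measurable_kernel (hrep : IsLePageRepresentation H P b f P₁ F ε P₂) :
    Measurable fun ω t => f t ω :=
  measurable_pi_lambda _ hrep.process.measurable

lemma IsLePageRepresentation.truncIntensity_lt_top [IsProbabilityMeasure P₁]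
    (hrep : IsLePageRepresentation H P b f P₁ F ε P₂) :
    truncIntensity (P₁.map fun ω t => f t ω) 1 < ∞ := by
  rw [truncIntensity, lintegral_map (Measurable.lintegral_prod_right'
    (f := fun z : (ℝ≥0 → EReal) × ℝ =>
      min 1 (evalRight z.1 z.2.toNNReal).abs / ENNReal.ofReal (z.2 ^ 2)) (by fun_prop))
    hrep.measurable_kernel]
  simp_rw [(hrep.cadlag _).evalRight_eq]
  exact hrep.integral_lt_top

/-- Summands of size below `κ` grow at a rate that vanishes with `κ`, and larger ones are unlikely
at small times, so a negative drift would make the series negative with positive probability. -/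
lemma IsLePageRepresentation.drift_nonneg [IsProbabilityMeasure P₁] [IsProbabilityMeasure P₂]
    (hrep : IsLePageRepresentation H P b f P₁ F ε P₂)
    (hmono : ∀ᵐ ω ∂P, Monotone fun t => H t ω) : 0 ≤ b := by
  by_contra! hb
  set γ := P₁.map fun ω t => f t ω with hγ
  have : IsProbabilityMeasure γ := Measure.isProbabilityMeasure_map hrep.measurable_kernel.aemeasurable
  obtain ⟨n, hn⟩ := ((tendsto_truncIntensity γ hrep.truncIntensity_lt_top.ne).eventually
    (gt_mem_nhds (show (0 : ℝ≥0∞) < ENNReal.ofReal (-b) by simpa using hb))).exists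
  set κ : ℝ≥0∞ := ((n : ℝ≥0∞) + 1)⁻¹ with hκ
  have hκ' : κ = ENNReal.ofReal (((n : ℝ) + 1)⁻¹) := by
    rw [hκ, ENNReal.ofReal_inv_of_pos (by positivity), ENNReal.ofReal_add (by positivity) one_pos.le]
    simp
  -- the time `t` for which the drift has covered the distance `-κ`
  set t : ℝ≥0 := (((n : ℝ) + 1)⁻¹ / (-b)).toNNReal with ht
  have hb' : 0 < -b := by linarith
  have htpos : 0 < t := Real.toNNReal_pos.2 (by positivity)
  have htb : b * (t : ℝ) = -((n : ℝ) + 1)⁻¹ := by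
    rw [ht, Real.coe_toNNReal _ (by positivity)]
    field_simp [hb.ne]
  have hκt : κ = t * ENNReal.ofReal (-b) := by
    rw [hκ', ← ENNReal.ofReal_coe_nnreal, ← ENNReal.ofReal_mul t.coe_nonneg]
    congr 1
    linarith
  have hint := lintegral_truncSum hrep.measurable_copy hrep.measurable_exp (γ := γ)
    (fun k => (hrep.sameLaw_copy k).map_eq (hrep.process_copy k).measurable
      hrep.process.measurable) hrep.law_exp hrep.indep_exp hrep.indep κ htpos
  have hlt : ∫⁻ ω, truncSum (fun k ω t => F k t ω) ε κ t ω ∂P₂ < κ := by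
    rw [hint]
    nth_rw 2 [hκt]
    exact ENNReal.mul_lt_mul_right (by simpa using htpos.ne') ENNReal.coe_ne_top hn
  refine absurd hlt (not_lt.2 ?_)
  calc κ = ∫⁻ _, κ ∂P₂ := by simp
    _ ≤ _ := lintegral_mono_ae ?_
  filter_upwards [hrep.ae_lePageSeries_le hmono (zero_le : (0 : ℝ≥0) ≤ t)] with ω hω
  by_contra! hcon
  rw [hκ'] at hcon
  obtain ⟨S, hS, hL⟩ := exists_lePageSeries_eq_of_truncSum_lt (b := b) hrep.cadlag_copy le_rfl hcon
  rw [lePageSeries_zero hrep.cadlag_copy, hL, htb] at hω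
  have := (abs_lt.1 hS).2
  have h0 : (0 : ℝ) ≤ -((n : ℝ) + 1)⁻¹ + S := by exact_mod_cast hω
  linarith

/-- If the drift and the expected truncated size at the times `s` and `t` are small, then the first
summand alone cannot drop by `δ` between `s` and `t`: given such a drop, the remaining terms would
fail to make up for it with positive conditional probability. -/
lemma IsLePageRepresentation.measure_drop_eq_zero [IsProbabilityMeasure P₁]
    [IsProbabilityMeasure P₂] (hrep : IsLePageRepresentation H P b f P₁ F ε P₂)
    (hmono : ∀ᵐ ω ∂P, Monotone fun t => H t ω) {s t : ℝ≥0} (hs : 0 < s) (hst : s ≤ t)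
    {c δ : ℝ} (hc1 : c ≤ 1) (hcδ : 4 * c ≤ δ) (hbt : |b| * t ≤ c)
    (hsmall : (s + t) * truncIntensity (P₁.map fun ω t => f t ω) 1 < ENNReal.ofReal c) :
    (P₁.map fun ω t => f t ω).prod (erlangMeasure 0)
      {z | evalRight z.1 (t / z.2.toNNReal) + δ < evalRight z.1 (s / z.2.toNNReal)} = 0 := by
  set γ := P₁.map fun ω t => f t ω with hγ
  have : IsProbabilityMeasure γ := Measure.isProbabilityMeasure_map hrep.measurable_kernel.aemeasurable
  set A : Set ((ℝ≥0 → EReal) × ℝ) :=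
    {z | evalRight z.1 (t / z.2.toNNReal) + δ < evalRight z.1 (s / z.2.toNNReal)} with hA
  have hAm : MeasurableSet A := measurableSet_lt
    ((Measurable.evalRight measurable_fst (by fun_prop)).add measurable_const)
    (Measurable.evalRight measurable_fst (by fun_prop))
  have hlawX : ∀ k, P₂.map (fun ω t => F k t ω) = γ := fun k =>
    (hrep.sameLaw_copy k).map_eq (hrep.process_copy k).measurable hrep.process.measurable
  set B : Set Ω₂ := {ω | ((fun t => F 0 t ω), ε 0 ω) ∈ A} with hB
  have hBm : MeasurableSet B := ((hrep.measurable_copy 0).prodMk (hrep.measurable_exp 0)) hAm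
  have hPB : P₂ B = γ.prod (erlangMeasure 0) A := by
    have hi : IndepFun (fun ω t => F 0 t ω) (ε 0) P₂ :=
      hrep.indep.comp (φ := fun p : ℕ → ℝ≥0 → EReal => p 0) (ψ := fun e : ℕ → ℝ => e 0)
        (by fun_prop) (by fun_prop)
    have hp := (indepFun_iff_map_prod_eq_prod_map_map (hrep.measurable_copy 0).aemeasurable
      (hrep.measurable_exp 0).aemeasurable).1 hi
    rw [hlawX, hrep.law_exp, expMeasure_one_eq_erlangMeasure] at hp
    rw [← hp, Measure.map_apply ((hrep.measurable_copy 0).prodMk (hrep.measurable_exp 0)) hAm]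
    rfl
  have htail : ∀ u : ℝ≥0, 0 < u →
      ∫⁻ ω in B, truncTail (fun k ω t => F k t ω) ε 1 u ω ∂P₂ ≤
        γ.prod (erlangMeasure 0) A * (u * truncIntensity γ 1) := fun u hu =>
    setLIntegral_truncTail_le hrep.measurable_copy hrep.measurable_exp hlawX hrep.law_exp
      hrep.indep_copy hrep.indep_exp hrep.indep 1 hu hAm
  have hlow : ENNReal.ofReal c * P₂ B ≤ ∫⁻ ω in B, (truncTail (fun k ω t => F k t ω) ε 1 s ω +
      truncTail (fun k ω t => F k t ω) ε 1 t ω) ∂P₂ := by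
    rw [← setLIntegral_const]
    refine setLIntegral_mono_ae' hBm ?_
    filter_upwards [hrep.ae_lePageSeries_le hmono hst] with ω hω hωB
    by_contra! hcon
    have hc1' : ENNReal.ofReal c ≤ 1 := by simpa using hc1
    obtain ⟨S, hS, hLs⟩ := exists_lePageSeries_eq_of_truncTail_lt (b := b) hrep.cadlag_copy hc1'
      (le_self_add.trans_lt hcon)
    obtain ⟨T, hT, hLt⟩ := exists_lePageSeries_eq_of_truncTail_lt (b := b) hrep.cadlag_copy hc1'
      (le_add_self.trans_lt hcon)
    rw [hLs, hLt] at hω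
    simp only [hB, hA, Set.mem_ofPred_eq, (hrep.cadlag_copy _ _).evalRight_eq] at hωB
    refine absurd hω (not_le.2 (EReal.add_coe_lt_add_coe_of_gap
      ((hrep.cadlag_copy 0 ω).ne_bot _) hωB ?_))
    have h1 : |b * (t : ℝ)| ≤ c := by rwa [abs_mul, NNReal.abs_eq]
    have h2 : |b * (s : ℝ)| ≤ c := by
      rw [abs_mul, NNReal.abs_eq]
      refine le_trans ?_ hbt
      gcongr
    have := abs_lt.1 hS
    have := abs_lt.1 hT
    have := abs_le.1 h1
    have := abs_le.1 h2
    linarith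
  rw [lintegral_add_left (measurable_truncTail hrep.measurable_copy hrep.measurable_exp 1 s), hPB]
    at hlow
  have hup := hlow.trans (add_le_add (htail s hs) (htail t (hs.trans_le hst)))
  rw [← mul_add, ← add_mul, mul_comm] at hup
  by_contra hne
  exact absurd ((ENNReal.mul_le_mul_iff_right hne (measure_ne_top _ _)).1 hup) (not_le.2 hsmall)

/-- The kernel process of a monotone LePage series is monotone along a given pair of times up to an
arbitrarily small error. The time scaling `s = r u`, `t = r v` with small `r` makes all but the first
summand negligible. -/
lemma IsLePageRepresentation.ae_kernel_le_add [IsProbabilityMeasure P₁] [IsProbabilityMeasure P₂]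
    (hrep : IsLePageRepresentation H P b f P₁ F ε P₂)
    (hmono : ∀ᵐ ω ∂P, Monotone fun t => H t ω) {u v : ℝ≥0} (hu : 0 < u) (huv : u ≤ v)
    {δ : ℝ} (hδ : 0 < δ) (hδ1 : δ ≤ 1) :
    ∀ᵐ ω ∂P₁, f u ω ≤ f v ω + δ := by
  set γ := P₁.map fun ω t => f t ω with hγ
  have : IsProbabilityMeasure γ := Measure.isProbabilityMeasure_map hrep.measurable_kernel.aemeasurable
  have hΦ := hrep.truncIntensity_lt_top.ne
  rw [← hγ] at hΦ
  set Φ : ℝ := (truncIntensity γ 1).toReal with hΦdef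
  have hΦ0 : 0 ≤ Φ := ENNReal.toReal_nonneg
  set c : ℝ := δ / 4 with hc
  have hcpos : 0 < c := by positivity
  -- the scale `r` keeps both the drift at `r v` and the expected size of the later terms below `c`
  set r : ℝ≥0 := (c / (|b| * v + (u + v) * Φ + 1)).toNNReal with hr
  have hden : 0 < |b| * v + (u + v) * Φ + 1 := by positivity
  have hrc : (r : ℝ) = c / (|b| * v + (u + v) * Φ + 1) := Real.coe_toNNReal _ (by positivity)
  have hrpos : 0 < r := Real.toNNReal_pos.2 (by positivity)
  have hreq : r * (|b| * v) + r * ((u + v) * Φ) + r = c := by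
    rw [hrc]; field_simp
  have hr0 : (0 : ℝ) < r := by exact_mod_cast hrpos
  have hx1 : 0 ≤ r * (|b| * v) := by positivity
  have hx2 : 0 ≤ r * ((u + v) * Φ) := by positivity
  have hdrop := hrep.measure_drop_eq_zero hmono (s := r * u) (t := r * v) (by positivity)
    (by gcongr) (c := c) (δ := δ) (by linarith) (by linarith)
    (by push_cast; linarith) (by
      rw [← hγ, ← ENNReal.ofReal_toReal hΦ, ← ENNReal.coe_add, ← ENNReal.ofReal_coe_nnreal,
        ← ENNReal.ofReal_mul (by positivity), ENNReal.ofReal_lt_ofReal_iff hcpos]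
      push_cast
      nlinarith)
  have hae := Measure.ae_ae_of_ae_prod (measure_eq_zero_iff_ae_notMem.1 hdrop)
  have hae' := ae_of_ae_map hrep.measurable_kernel.aemeasurable hae
  filter_upwards [hae'] with ω hω
  have hcad := hrep.cadlag ω
  rw [erlangMeasure, ae_withDensity_iff (by fun_prop), ae_restrict_iff' measurableSet_Ioi] at hω
  have hω' : ∀ᵐ x : ℝ, 0 < x →
      f (r * u / x.toNNReal) ω ≤ f (r * v / x.toNNReal) ω + δ := by
    filter_upwards [hω] with x hx hxpos
    have := hx hxpos (by simpa using Real.exp_pos _)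
    simpa [hcad.evalRight_eq] using this
  -- approach `x = r` from the left, so that `r u / x` decreases to `u`
  have hfreq : ∃ᶠ x in 𝓝[<] (r : ℝ), 0 < x ∧
      f (r * u / x.toNNReal) ω ≤ f (r * v / x.toNNReal) ω + δ := by
    intro hev
    obtain ⟨l, hl, hlsub⟩ := (mem_nhdsLT_iff_exists_Ioo_subset' (show (0 : ℝ) < r from hr0)).1
      (show _ ∈ 𝓝[<] (r : ℝ) from hev)
    have hvol : volume (Set.Ioo (max l 0) (r : ℝ)) = 0 := by
      refine measure_mono_null ?_ (ae_iff.1 hω')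
      intro x hx hcon
      exact hlsub ⟨(le_max_left _ _).trans_lt hx.1, hx.2⟩
        ⟨(le_max_right _ _).trans_lt hx.1, hcon ((le_max_right _ _).trans_lt hx.1)⟩
    rw [Real.volume_Ioo, ENNReal.ofReal_eq_zero, sub_nonpos] at hvol
    exact absurd hvol (not_le.2 (max_lt hl hr0))
  have hlim : ∀ w : ℝ≥0, Tendsto (fun x : ℝ => f (r * w / x.toNNReal) ω) (𝓝[<] (r : ℝ))
      (𝓝 (f w ω)) := fun w => by
    refine (hcad.right_cont w).tendsto.comp (tendsto_nhdsWithin_iff.2 ⟨?_, ?_⟩)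
    · have h1 : Tendsto (fun x : ℝ => r * w / x.toNNReal) (𝓝 (r : ℝ)) (𝓝 (r * w / r)) := by
        refine Tendsto.div tendsto_const_nhds ?_ hrpos.ne'
        simpa using (continuous_real_toNNReal.tendsto (r : ℝ))
      rw [mul_div_cancel_left₀ _ hrpos.ne'] at h1
      exact h1.mono_left nhdsWithin_le_nhds
    · filter_upwards [Ioo_mem_nhdsLT hr0] with x hx
      have hx0 : 0 < x.toNNReal := Real.toNNReal_pos.2 hx.1
      rw [Set.mem_Ici, le_div_iff₀ hx0, mul_comm]
      gcongr
      exact Real.toNNReal_le_iff_le_coe.2 hx.2.le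
  have hadd : Tendsto (fun y : EReal => y + δ) (𝓝 (f v ω)) (𝓝 (f v ω + δ)) := by
    have := EReal.continuousAt_add (p := (f v ω, (δ : EReal))) (Or.inr (by simp)) (Or.inr (by simp))
    exact this.tendsto.comp (tendsto_id.prodMk_nhds tendsto_const_nhds)
  exact le_of_tendsto_of_tendsto_of_frequently (hlim u) (hadd.comp (hlim v))
    (hfreq.mono fun x hx => hx.2)

lemma IsLePageRepresentation.ae_kernel_le [IsProbabilityMeasure P₁] [IsProbabilityMeasure P₂]
    (hrep : IsLePageRepresentation H P b f P₁ F ε P₂)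
    (hmono : ∀ᵐ ω ∂P, Monotone fun t => H t ω) {u v : ℝ≥0} (hu : 0 < u) (huv : u ≤ v) :
    ∀ᵐ ω ∂P₁, f u ω ≤ f v ω := by
  have h : ∀ᵐ ω ∂P₁, ∀ n : ℕ, f u ω ≤ f v ω + ((1 / ((n : ℝ) + 1) : ℝ) : EReal) :=
    ae_all_iff.2 fun n => hrep.ae_kernel_le_add hmono hu huv (by positivity)
      (by rw [div_le_one (by positivity)]; simp)
  filter_upwards [h] with ω hω
  have hadd : Tendsto (fun y : EReal => f v ω + y) (𝓝 ((0 : ℝ) : EReal))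
      (𝓝 (f v ω + ((0 : ℝ) : EReal))) := by
    have := EReal.continuousAt_add (p := (f v ω, ((0 : ℝ) : EReal))) (Or.inr (by simp))
      (Or.inr (by simp))
    exact this.tendsto.comp (tendsto_const_nhds.prodMk_nhds tendsto_id)
  have hl := hadd.comp ((continuous_coe_real_ereal.tendsto 0).comp
    (tendsto_one_div_add_atTop_nhds_zero_nat (𝕜 := ℝ)))
  rw [EReal.coe_zero, add_zero] at hl
  exact ge_of_tendsto' hl hω

lemma monotone_of_right_cont {g : ℝ≥0 → EReal} (hg : ∀ t, ContinuousWithinAt g (Set.Ici t) t)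
    {D : Set ℝ≥0} (hD : Dense D) (h : ∀ u ∈ D, ∀ v ∈ D, 0 < u → u ≤ v → g u ≤ g v) :
    Monotone g := by
  refine monotone_iff_forall_lt.2 fun u v huv => ?_
  have hfreq : ∀ w : ℝ≥0, ∃ᶠ x in 𝓝[>] w, x ∈ D := fun w hev => by
    obtain ⟨l, hl, hsub⟩ := mem_nhdsGT_iff_exists_Ioo_subset.1 (show _ ∈ 𝓝[>] w from hev)
    obtain ⟨x, hxD, hx⟩ := hD.exists_between (Set.mem_Ioi.1 hl)
    exact hsub hx hxD
  have hlim : ∀ w : ℝ≥0, Tendsto g (𝓝[>] w) (𝓝 (g w)) := fun w =>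
    (hg w).mono_left (nhdsWithin_mono _ Set.Ioi_subset_Ici_self)
  have h1 : ∀ d ∈ D, u < d → g u ≤ g d := fun d hd hud => by
    refine le_of_tendsto_of_frequently (hlim u)
      (((hfreq u).and_eventually (Ioo_mem_nhdsGT hud)).mono fun x hx => ?_)
    exact h x hx.1 d hd ((zero_le).trans_lt hx.2.1) hx.2.2.le
  exact ge_of_tendsto_of_frequently (hlim v)
    (((hfreq v).and_eventually self_mem_nhdsWithin).mono fun x hx => h1 x hx.1 (huv.trans hx.2))

end Representation

theorem lemma1 {Ω Ω₁ Ω₂ : Type*}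
    [MeasurableSpace Ω] [MeasurableSpace Ω₁] [MeasurableSpace Ω₂]
    (P : Measure Ω) [IsProbabilityMeasure P]
    (P₁ : Measure Ω₁) [IsProbabilityMeasure P₁]
    (P₂ : Measure Ω₂) [IsProbabilityMeasure P₂]
    (H : ℝ≥0 → Ω → EReal) (hH : IsProcess H)
    (hmono : ∀ᵐ ω ∂P, Monotone fun t => H t ω)
    (hright : ∀ᵐ ω ∂P, ∀ t, ContinuousWithinAt (fun s => H s ω) (Set.Ici t) t)
    (hIDT : IsStrongIDT H P)
    (b : ℝ) (f : ℝ≥0 → Ω₁ → EReal) (F : ℕ → ℝ≥0 → Ω₂ → EReal) (ε : ℕ → Ω₂ → ℝ)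
    (hrep : IsLePageRepresentation H P b f P₁ F ε P₂) :
    (∀ᵐ ω ∂P₁, Monotone fun t => f t ω) ∧ 0 ≤ b := by
  refine ⟨?_, hrep.drift_nonneg hmono⟩
  obtain ⟨D, hDc, hD⟩ := TopologicalSpace.exists_countable_dense ℝ≥0
  have h : ∀ᵐ ω ∂P₁, ∀ u ∈ D, ∀ v ∈ D, 0 < u → u ≤ v → f u ω ≤ f v ω := by
    refine (ae_ball_iff hDc).2 fun u _ => (ae_ball_iff hDc).2 fun v _ => ?_
    by_cases huv : 0 < u ∧ u ≤ v
    · filter_upwards [hrep.ae_kernel_le hmono huv.1 huv.2] with ω hω _ _ using hω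
    · exact Eventually.of_forall fun ω h1 h2 => absurd ⟨h1, h2⟩ huv
  filter_upwards [h] with ω hω
  exact monotone_of_right_cont (hrep.cadlag ω).right_cont hD hω
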